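/- Consider three parties $1,2,3$ and the triangle network, in which, for each $j$, a bipartite source $j$ sends one subsystem to each of the two parties other than $j$; each party $i$ produces an outcome $a_i$ from an input $x_i$ and the subsystems it receives. A \emph{setup} is a finite arrangement of independent copies of these parties and sources in which every copy of party $i$ receives one subsystem from a copy of each source $j\ne i$, and each subsystem emitted by a copy of a source reaches at most one agent (it is not cloned, but it may remain unused). A correlation $Q(a_1a_2a_3|x_1x_2x_3)$ is a \emph{triangle correlation} if one can assign to every setup a conditional probability distribution of the outcomes of its agents given their inputs so that: (i) any two identical parts (sets of agents with the sources that feed them, wired in the same way) of any two setups have the same marginal behaviour, independently of the inputs elsewhere; (ii) any two parts of a setup that have no source in common are statistically independent; (iii) the distribution assigned to the original setup, with one copy of each party and source, is $Q$. A nonsignalling correlation $P(a_1a_2a_3|x_1x_2x_3)$ is \emph{genuinely LOSR tripartite nonlocal} if it is not of the form $P=\int Q_\lambda\,d\mu(\lambda)$ with $\mu$ a probability measure (the randomness shared by all three parties) and each $Q_\lambda$ a triangle correlation; that is, if no bipartite resources of any causal theory with device replication (in particular of any generalized probabilistic theory), together with shared randomness, can produce it. Proposition. There are finitely many measurements, each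 with finitely many outcomes, for each of the three parties on its qubit of the state $|W\rangle=(|001\rangle+|010\rangle+|100\rangle)/\sqrt3$ such that the resulting correlation $P(a_1a_2a_3|x_1x_2x_3)$ is genuinely LOSR tripartite nonlocal. -/

import Mathlib

open scoped ComplexOrder

namespace LOSR

/- Parties are labelled by `Fin 3` (Alice, Bob, Charlie). The three bipartite sources are also
labelled by `Fin 3`: source `j` is the one shared by the two parties different from `j`. -/

/-- A tripartite family of conditional probabilities: `P x a` is the probability of the outcomes
`a 0, a 1, a 2` given the inputs `x 0, x 1, x 2`. -/
abbrev Behaviour (X A : Fin 3 → Type) : Type := (∀ i, X i) → (∀ i, A i) → ℝ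

/-- Nonsignalling correlations: conditional probability distributions such that the marginal of any
group `S` of parties does not depend on the inputs of the other parties. -/
structure IsNonsignalling {X A : Fin 3 → Type} [∀ i, Fintype (A i)] [∀ i, DecidableEq (A i)]
    (P : Behaviour X A) : Prop where
  nonneg : ∀ x a, 0 ≤ P x a
  sum_eq_one : ∀ x, ∑ a, P x a = 1
  nonsignalling : ∀ (S : Finset (Fin 3)) (x x' : ∀ i, X i), (∀ i ∈ S, x i = x' i) →
    ∀ b : ∀ i, A i,
      ∑ a with (∀ i ∈ S, a i = b i), P x a = ∑ a with (∀ i ∈ S, a i = b i), P x' a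

/-- A setup assembled from independent copies of the devices of the triangle network (a nonfanout
inflation of it). It has `numAgents i` copies of party `i` and `numSources j` copies of source `j`.
Each copy of party `i` receives one subsystem from a copy of each of the two sources `j ≠ i`.
Injectivity says that nothing is cloned: the subsystem that a copy of source `j` emits for party `i`
reaches at most one copy of party `i`. It may also remain unused. -/
structure Setup where
  numAgents : Fin 3 → ℕ
  numSources : Fin 3 → ℕ
  wire : ∀ i j : Fin 3, i ≠ j → Fin (numAgents i) → Fin (numSources j)
  nonfanout : ∀ (i j : Fin 3) (h : i ≠ j), Function.Injective (wire i j h)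

/-- The original setup: one copy of each party and of each source. -/
def Setup.triangle : Setup where
  numAgents := fun _ => 1
  numSources := fun _ => 1
  wire := fun _ _ _ v => v
  nonfanout := fun _ _ _ => Function.injective_id

/-- An identification of `H` with a part of `G`, namely a set of agents of `G` together with the
sources that feed them, wired in the same way. -/
structure Setup.Embedding (H G : Setup) where
  agent : ∀ i, Fin (H.numAgents i) → Fin (G.numAgents i)
  source : ∀ j, Fin (H.numSources j) → Fin (G.numSources j)
  agent_injective : ∀ i, Function.Injective (agent i)
  source_injective : ∀ j, Function.Injective (source j)
  wire_comm : ∀ (i j : Fin 3) (h : i ≠ j) (v : Fin (H.numAgents i)),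
    G.wire i j h (agent i v) = source j (H.wire i j h v)

/-- An assignment of a letter (an input or an outcome) to every agent of a setup. -/
abbrev Setup.Labelling (G : Setup) (L : Fin 3 → Type) : Type := ∀ i, Fin (G.numAgents i) → L i

/-- The labelling of the agents of a part of a setup. -/
def Setup.Embedding.restrict {H G : Setup} (f : H.Embedding G) {L : Fin 3 → Type}
    (l : G.Labelling L) : H.Labelling L :=
  fun i v => l i (f.agent i v)

/-- A causal theory with device replication, as seen through three fixed parties and three fixed
bipartite sources (and a fixed value of the shared randomness): it predicts a conditional
probability distribution for every setup that can be assembled from copies of these devices.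
`causality`: identical parts of any two setups have the same behaviour, whatever happens elsewhere.
`independence`: two parts that have no source in common are uncorrelated. -/
structure TriangleTheory (X A : Fin 3 → Type) [∀ i, Fintype (A i)] [∀ i, DecidableEq (A i)] where
  prob : ∀ G : Setup, G.Labelling X → G.Labelling A → ℝ
  nonneg : ∀ (G : Setup) (x : G.Labelling X) (a : G.Labelling A), 0 ≤ prob G x a
  sum_eq_one : ∀ (G : Setup) (x : G.Labelling X), ∑ a, prob G x a = 1
  causality : ∀ (H G : Setup) (f : H.Embedding G) (x : G.Labelling X) (b : H.Labelling A),
    ∑ a with f.restrict a = b, prob G x a = prob H (f.restrict x) b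
  independence : ∀ (G H₁ H₂ : Setup) (f₁ : H₁.Embedding G) (f₂ : H₂.Embedding G),
    (∀ j s₁ s₂, f₁.source j s₁ ≠ f₂.source j s₂) →
    (∀ i v, (∃ w, f₁.agent i w = v) ∨ (∃ w, f₂.agent i w = v)) →
    ∀ (x : G.Labelling X) (a : G.Labelling A),
      prob G x a =
        prob H₁ (f₁.restrict x) (f₁.restrict a) * prob H₂ (f₂.restrict x) (f₂.restrict a)

variable {X A : Fin 3 → Type} [∀ i, Fintype (A i)] [∀ i, DecidableEq (A i)]

/-- `P` arises in the triangle network of bipartite sources, without shared randomness, in some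
causal theory. -/
def IsTriangleCorrelation (P : Behaviour X A) : Prop :=
  ∃ T : TriangleTheory X A, ∀ x a,
    T.prob Setup.triangle (fun i _ => x i) (fun i _ => a i) = P x a

/-- `P` arises from bipartite resources of some causal theory together with randomness `ω` shared by
all three parties and distributed according to an arbitrary probability measure. -/
def IsBipartiteWithSharedRandomness (P : Behaviour X A) : Prop :=
  ∃ (Ω : Type) (_ : MeasurableSpace Ω) (μ : MeasureTheory.Measure Ω) (Q : Ω → Behaviour X A),
    MeasureTheory.IsProbabilityMeasure μ ∧
    (∀ ω, IsTriangleCorrelation (Q ω)) ∧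
    (∀ x a, Measurable fun ω => Q ω x a) ∧
    ∀ x a, P x a = ∫ ω, Q ω x a ∂μ

/-- Genuine LOSR tripartite nonlocality. -/
def IsGenuinelyLOSRTripartiteNonlocal (P : Behaviour X A) : Prop :=
  IsNonsignalling P ∧ ¬ IsBipartiteWithSharedRandomness P

/-- A measurement of a qubit with outcomes in `O` (a positive operator-valued measure). -/
structure QubitMeasurement (O : Type) [Fintype O] where
  effect : O → Matrix (Fin 2) (Fin 2) ℂ
  posSemidef : ∀ o, (effect o).PosSemidef
  sum_eq_one : ∑ o, effect o = 1

/-- The computational basis vector `|s 0, s 1, s 2⟩` of three qubits. -/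
def ket (s : Fin 3 → Fin 2) : (Fin 3 → Fin 2) → ℂ := Pi.single s 1

/-- The W state `(|001⟩ + |010⟩ + |100⟩) / √3`. -/
noncomputable def wState : (Fin 3 → Fin 2) → ℂ :=
  (1 / (Real.sqrt 3 : ℂ)) • (ket ![0, 0, 1] + ket ![0, 1, 0] + ket ![1, 0, 0])

/-- The tensor product `E 0 ⊗ E 1 ⊗ E 2` of three one-qubit operators. -/
def tensorOp (E : Fin 3 → Matrix (Fin 2) (Fin 2) ℂ) :
    Matrix (Fin 3 → Fin 2) (Fin 3 → Fin 2) ℂ :=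
  Matrix.of fun s t => ∏ i, E i (s i) (t i)

/-- The Born rule: the correlation obtained when party `i` performs the measurement `M i (x i)` on
qubit `i` of the pure state `ψ`. -/
noncomputable def bornBehaviour (ψ : (Fin 3 → Fin 2) → ℂ)
    (M : ∀ i, X i → QubitMeasurement (A i)) : Behaviour X A :=
  fun x a => (star ψ ⬝ᵥ (tensorOp (fun i => (M i (x i)).effect (a i))).mulVec ψ).re

end LOSR

/-! Measure every qubit of W in the computational basis (input 0): exactly one party obtains 1. Let
`t i` be the probability that it is party `i`, in a triangle correlation with this property.

Unwrap the triangle into a ring of six agents. Neighbours look as they do in the triangle, so they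
never both obtain 1; agents that are not neighbours share no source, so they are independent.
Inclusion-exclusion on the ring gives `2 * t 0 * t 1 * t 2 ≤ (1 - t 0 - t 1 - t 2) ^ 2 = 0`
(`mean_inequality`), hence some `t i` vanishes: without shared randomness the winner cannot be
random among all three.

If `t i = 0`, then in each of the two pairs containing `i` only one of the two opposite outcome
pairs can occur, given that the third party obtains 0. The disagreement is then a difference of
marginals, which nonsignalling alone bounds by a chained Bell expression (`le_chainedBell`). Adding
both pairs, the three chained expressions sum to at least `t 0 + t 1 + t 2 = 1`. This bound is
linear, so it survives shared randomness.

For W, outcome 0 of one party leaves the other two maximally entangled, and five settings near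
multiples of `π / 5` bring the sum below 1. -/

namespace LOSR

/-! ### Parts and disjoint unions of setups; the hexagon. -/

namespace Setup

/-- The part of the triangle made of the parties in `U` and the sources in `V`. -/
def part (U V : Finset (Fin 3)) (hUV : ∀ i ∈ U, ∀ j, i ≠ j → j ∈ V) : Setup where
  numAgents k := if k ∈ U then 1 else 0
  numSources j := if j ∈ V then 1 else 0
  wire i j h v := ⟨0, by
    have hi : i ∈ U := by
      by_contra hi
      have := v.isLt
      simp [hi] at this
    simp [hUV i hi j h]⟩
  nonfanout i j h v w _ := by
    apply Fin.ext
    have hv := v.isLt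
    have hw := w.isLt
    split_ifs at hv hw <;> omega

variable {U V : Finset (Fin 3)} {hUV : ∀ i ∈ U, ∀ j, i ≠ j → j ∈ V}

/-- The agent of a party in `U`. -/
def partAgent (hUV : ∀ i ∈ U, ∀ j, i ≠ j → j ∈ V) (i : Fin 3) (hi : i ∈ U) :
    Fin ((part U V hUV).numAgents i) :=
  ⟨0, by simp [part, hi]⟩

lemma mem_of_partAgent {i : Fin 3} (v : Fin ((part U V hUV).numAgents i)) : i ∈ U := by
  by_contra hi
  have := v.isLt
  simp [part, hi] at this

lemma partAgent_subsingleton {i : Fin 3} (v w : Fin ((part U V hUV).numAgents i)) : v = w := by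
  apply Fin.ext
  have hv := v.isLt
  have hw := w.isLt
  simp only [part] at hv hw
  split_ifs at hv hw <;> omega

lemma partSource_subsingleton {j : Fin 3} (v w : Fin ((part U V hUV).numSources j)) : v = w := by
  apply Fin.ext
  have hv := v.isLt
  have hw := w.isLt
  simp only [part] at hv hw
  split_ifs at hv hw <;> omega

/-- The identification of a part of the triangle with the agents `v` and sources `s` of `G`. -/
def partEmbedding (hUV : ∀ i ∈ U, ∀ j, i ≠ j → j ∈ V) (G : Setup)
    (v : ∀ i, Fin (G.numAgents i)) (s : ∀ j, Fin (G.numSources j))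
    (h : ∀ i ∈ U, ∀ j (hij : i ≠ j), G.wire i j hij (v i) = s j) :
    (part U V hUV).Embedding G where
  agent i _ := v i
  source j _ := s j
  agent_injective _ _ _ _ := partAgent_subsingleton _ _
  source_injective _ _ _ _ := partSource_subsingleton _ _
  wire_comm i j hij w := h i (mem_of_partAgent w) j hij

/-- The disjoint union of two setups. -/
def union (H₁ H₂ : Setup) : Setup where
  numAgents i := H₁.numAgents i + H₂.numAgents i
  numSources j := H₁.numSources j + H₂.numSources j
  wire i j h := Fin.addCases (fun v => Fin.castAdd _ (H₁.wire i j h v))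
    (fun v => Fin.natAdd _ (H₂.wire i j h v))
  nonfanout i j h v w := by
    refine Fin.addCases (fun v => ?_) (fun v => ?_) v <;>
    refine Fin.addCases (fun w => ?_) (fun w => ?_) w <;>
    simp only [Fin.addCases_left, Fin.addCases_right] <;> intro hvw
    · rw [H₁.nonfanout i j h (Fin.castAdd_injective _ _ hvw)]
    · have h1 := congrArg Fin.val hvw
      have h2 := (H₁.wire i j h v).isLt
      simp only [Fin.val_castAdd, Fin.val_natAdd] at h1
      omega
    · have h1 := congrArg Fin.val hvw
      have h2 := (H₁.wire i j h w).isLt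
      simp only [Fin.val_castAdd, Fin.val_natAdd] at h1
      omega
    · rw [H₂.nonfanout i j h (Fin.natAdd_injective _ _ hvw)]

/-- The first summand of a disjoint union. -/
def inl (H₁ H₂ : Setup) : H₁.Embedding (H₁.union H₂) where
  agent _ := Fin.castAdd _
  source _ := Fin.castAdd _
  agent_injective _ := Fin.castAdd_injective _ _
  source_injective _ := Fin.castAdd_injective _ _
  wire_comm _ _ _ _ := by simp [union]

/-- The second summand of a disjoint union. -/
def inr (H₁ H₂ : Setup) : H₂.Embedding (H₁.union H₂) where
  agent _ := Fin.natAdd _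
  source _ := Fin.natAdd _
  agent_injective _ := Fin.natAdd_injective _ _
  source_injective _ := Fin.natAdd_injective _ _
  wire_comm _ _ _ _ := by simp [union]

namespace Embedding

variable {H₁ H₂ G : Setup}

/-- Two parts of a setup have no source in common. -/
def Disjoint (f₁ : H₁.Embedding G) (f₂ : H₂.Embedding G) : Prop :=
  ∀ j s₁ s₂, f₁.source j s₁ ≠ f₂.source j s₂

/-- Every agent is fed by some source, so a common agent would force a common source. -/
lemma Disjoint.agent_ne {f₁ : H₁.Embedding G} {f₂ : H₂.Embedding G} (h : f₁.Disjoint f₂)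
    (i : Fin 3) (v : Fin (H₁.numAgents i)) (w : Fin (H₂.numAgents i)) :
    f₁.agent i v ≠ f₂.agent i w := by
  intro hvw
  obtain ⟨j, hj⟩ : ∃ j : Fin 3, i ≠ j := by
    obtain ⟨j, hj⟩ := exists_ne i
    exact ⟨j, hj.symm⟩
  apply h j (H₁.wire i j hj v) (H₂.wire i j hj w)
  rw [← f₁.wire_comm, ← f₂.wire_comm, hvw]

/-- The union of two parts of a setup that have no source in common. -/
def union (f₁ : H₁.Embedding G) (f₂ : H₂.Embedding G) (h : f₁.Disjoint f₂) :
    (H₁.union H₂).Embedding G where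
  agent i := Fin.addCases (f₁.agent i) (f₂.agent i)
  source j := Fin.addCases (f₁.source j) (f₂.source j)
  agent_injective i v w := by
    refine Fin.addCases (fun v => ?_) (fun v => ?_) v <;>
    refine Fin.addCases (fun w => ?_) (fun w => ?_) w <;>
    simp only [Fin.addCases_left, Fin.addCases_right] <;> intro hvw
    · rw [f₁.agent_injective i hvw]
    · exact absurd hvw (h.agent_ne i _ _)
    · exact absurd hvw.symm (h.agent_ne i _ _)
    · rw [f₂.agent_injective i hvw]
  source_injective j v w := by
    refine Fin.addCases (fun v => ?_) (fun v => ?_) v <;>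
    refine Fin.addCases (fun w => ?_) (fun w => ?_) w <;>
    simp only [Fin.addCases_left, Fin.addCases_right] <;> intro hvw
    · rw [f₁.source_injective j hvw]
    · exact absurd hvw (h j _ _)
    · exact absurd hvw.symm (h j _ _)
    · rw [f₂.source_injective j hvw]
  wire_comm i j hij v := by
    refine Fin.addCases (fun v => ?_) (fun v => ?_) v
    · simp [Setup.union, f₁.wire_comm]
    · simp [Setup.union, f₂.wire_comm]

lemma Disjoint.union_right {H₃ : Setup} {f₁ : H₁.Embedding G} {f₂ : H₂.Embedding G}
    {f₃ : H₃.Embedding G} (h₁₂ : f₁.Disjoint f₂) (h₁₃ : f₁.Disjoint f₃) (h₂₃ : f₂.Disjoint f₃) :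
    f₁.Disjoint (f₂.union f₃ h₂₃) := by
  intro j s₁ s
  refine Fin.addCases (fun s => ?_) (fun s => ?_) s
  · simpa [union] using h₁₂ j s₁ s
  · simpa [union] using h₁₃ j s₁ s

variable {L : Fin 3 → Type}

lemma restrict_inl_restrict_union (f₁ : H₁.Embedding G) (f₂ : H₂.Embedding G)
    (h : f₁.Disjoint f₂) (l : G.Labelling L) :
    (inl H₁ H₂).restrict ((f₁.union f₂ h).restrict l) = f₁.restrict l := by
  funext i v
  simp [restrict, inl, union]

lemma restrict_inr_restrict_union (f₁ : H₁.Embedding G) (f₂ : H₂.Embedding G)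
    (h : f₁.Disjoint f₂) (l : G.Labelling L) :
    (inr H₁ H₂).restrict ((f₁.union f₂ h).restrict l) = f₂.restrict l := by
  funext i v
  simp [restrict, inr, union]

end Embedding

/-- Labellings of a disjoint union. -/
def unionLabelling (H₁ H₂ : Setup) (L : Fin 3 → Type) :
    (H₁.union H₂).Labelling L ≃ H₁.Labelling L × H₂.Labelling L where
  toFun l := ((inl H₁ H₂).restrict l, (inr H₁ H₂).restrict l)
  invFun l i := Fin.addCases (l.1 i) (l.2 i)
  left_inv l := by
    funext i v
    refine Fin.addCases (fun v => ?_) (fun v => ?_) v <;> simp [Embedding.restrict, inl, inr]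
  right_inv l := by
    ext i v <;> simp [Embedding.restrict, inl, inr]

/-- The ring of six agents. -/
def hexagon : Setup where
  numAgents _ := 2
  numSources _ := 2
  -- Without the twist these would be two disjoint triangles. Crossing the links of party 0 to
  -- source 1 joins them into the ring 0₀, 1₀, 2₀, 0₁, 1₁, 2₁, where the subscript is the copy.
  wire i j _ v := if i = 0 ∧ j = 1 then v + 1 else v
  nonfanout i j _ v w h := by
    dsimp only at h
    split_ifs at h
    · exact add_right_cancel h
    · exact h

end Setup

/-! ### Expectations: marginals and independence. -/

namespace TriangleTheory

open Setup

variable {X A : Fin 3 → Type} [∀ i, Fintype (A i)] [∀ i, DecidableEq (A i)]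
  (T : TriangleTheory X A)

/-- The expectation of a function of the outcomes of the agents of a setup. -/
def expect (G : Setup) (x : G.Labelling X) (φ : G.Labelling A → ℝ) : ℝ :=
  ∑ a, T.prob G x a * φ a

lemma expect_restrict {H G : Setup} (f : H.Embedding G) (x : G.Labelling X)
    (φ : H.Labelling A → ℝ) :
    T.expect G x (fun a => φ (f.restrict a)) = T.expect H (f.restrict x) φ := by
  unfold expect
  rw [← Finset.sum_fiberwise Finset.univ (fun a : G.Labelling A => f.restrict a)]
  refine Finset.sum_congr rfl fun b _ => ?_
  rw [← T.causality H G f x b, Finset.sum_mul]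
  refine Finset.sum_congr rfl fun a ha => ?_
  simp only [(Finset.mem_filter.mp ha).2]

lemma expect_union (H₁ H₂ : Setup) (x : (H₁.union H₂).Labelling X)
    (φ : H₁.Labelling A → ℝ) (ψ : H₂.Labelling A → ℝ) :
    T.expect (H₁.union H₂) x
        (fun a => φ ((inl H₁ H₂).restrict a) * ψ ((inr H₁ H₂).restrict a)) =
      T.expect H₁ ((inl H₁ H₂).restrict x) φ * T.expect H₂ ((inr H₁ H₂).restrict x) ψ := by
  unfold expect
  rw [Fintype.sum_mul_sum, ← Fintype.sum_prod_type']
  refine Fintype.sum_equiv (unionLabelling H₁ H₂ A) _ _ fun a => ?_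
  rw [T.independence (H₁.union H₂) H₁ H₂ (inl H₁ H₂) (inr H₁ H₂)]
  · exact mul_mul_mul_comm _ _ _ _
  · intro j s₁ s₂ h
    have h1 := congrArg Fin.val h
    simp only [inl, inr, Fin.val_castAdd, Fin.val_natAdd] at h1
    omega
  · intro i v
    refine Fin.addCases (fun v => Or.inl ⟨v, rfl⟩) (fun v => Or.inr ⟨v, rfl⟩) v

/-- The field `independence` needs the two parts to exhaust the agents. Hence the rest of `G` is
first discarded by `causality`, through the embedding of the disjoint union, where the two summands
do exhaust everything. -/
lemma expect_mul {H₁ H₂ G : Setup} (f₁ : H₁.Embedding G) (f₂ : H₂.Embedding G)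
    (h : f₁.Disjoint f₂) (x : G.Labelling X)
    (φ : H₁.Labelling A → ℝ) (ψ : H₂.Labelling A → ℝ) :
    T.expect G x (fun a => φ (f₁.restrict a) * ψ (f₂.restrict a)) =
      T.expect H₁ (f₁.restrict x) φ * T.expect H₂ (f₂.restrict x) ψ := by
  have := T.expect_restrict (f₁.union f₂ h) x
    (fun a => φ ((inl H₁ H₂).restrict a) * ψ ((inr H₁ H₂).restrict a))
  rw [expect_union] at this
  simpa only [Embedding.restrict_inl_restrict_union, Embedding.restrict_inr_restrict_union]
    using this

lemma expect_mul_mul {H₁ H₂ H₃ G : Setup} (f₁ : H₁.Embedding G) (f₂ : H₂.Embedding G)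
    (f₃ : H₃.Embedding G) (h₁₂ : f₁.Disjoint f₂) (h₁₃ : f₁.Disjoint f₃) (h₂₃ : f₂.Disjoint f₃)
    (x : G.Labelling X)
    (φ : H₁.Labelling A → ℝ) (ψ : H₂.Labelling A → ℝ) (χ : H₃.Labelling A → ℝ) :
    T.expect G x (fun a => φ (f₁.restrict a) * (ψ (f₂.restrict a) * χ (f₃.restrict a))) =
      T.expect H₁ (f₁.restrict x) φ *
        (T.expect H₂ (f₂.restrict x) ψ * T.expect H₃ (f₃.restrict x) χ) := by
  have := T.expect_mul f₁ (f₂.union f₃ h₂₃) (h₁₂.union_right h₁₃ h₂₃) x φ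
    (fun a => ψ ((inl H₂ H₃).restrict a) * χ ((inr H₂ H₃).restrict a))
  rw [expect_union] at this
  simpa only [Embedding.restrict_inl_restrict_union, Embedding.restrict_inr_restrict_union]
    using this

lemma expect_const (G : Setup) (x : G.Labelling X) (c : ℝ) : T.expect G x (fun _ => c) = c := by
  simp [expect, ← Finset.sum_mul, T.sum_eq_one]

lemma expect_add (G : Setup) (x : G.Labelling X) (φ ψ : G.Labelling A → ℝ) :
    T.expect G x (fun a => φ a + ψ a) = T.expect G x φ + T.expect G x ψ := by
  simp [expect, mul_add, Finset.sum_add_distrib]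

lemma expect_mono (G : Setup) (x : G.Labelling X) {φ ψ : G.Labelling A → ℝ}
    (h : ∀ a, φ a ≤ ψ a) : T.expect G x φ ≤ T.expect G x ψ :=
  Finset.sum_le_sum fun a _ => mul_le_mul_of_nonneg_left (h a) (T.nonneg G x a)

lemma expect_part {U V : Finset (Fin 3)} (hUV : ∀ i ∈ U, ∀ j, i ≠ j → j ∈ V) (G : Setup)
    (v : ∀ i, Fin (G.numAgents i)) (s : ∀ j, Fin (G.numSources j))
    (h : ∀ i ∈ U, ∀ j (hij : i ≠ j), G.wire i j hij (v i) = s j)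
    (x : G.Labelling X) (φ : (∀ i ∈ U, A i) → ℝ) :
    T.expect G x (fun a => φ fun i _ => a i (v i)) =
      T.expect (part U V hUV) (fun i _ => x i (v i))
        (fun b => φ fun i hi => b i (partAgent hUV i hi)) :=
  T.expect_restrict (partEmbedding hUV G v s h) x
    (fun b => φ fun i hi => b i (partAgent hUV i hi))

/-- Parties in `U` behave in a setup as they do in the triangle, if they are wired in the same
way. -/
lemma expect_eq_triangle (U : Finset (Fin 3)) (G : Setup)
    (v : ∀ i, Fin (G.numAgents i)) (s : ∀ j, Fin (G.numSources j))
    (h : ∀ i ∈ U, ∀ j (hij : i ≠ j), G.wire i j hij (v i) = s j)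
    (x : G.Labelling X) (y : ∀ i, X i) (hxy : ∀ i ∈ U, x i (v i) = y i)
    (φ : (∀ i ∈ U, A i) → ℝ) :
    T.expect G x (fun a => φ fun i _ => a i (v i)) =
      T.expect triangle (fun i _ => y i) (fun a => φ fun i _ => a i (0 : Fin 1)) := by
  -- Both sides are compared with one common part. Keeping all three sources in it is harmless, as
  -- no independence is claimed here.
  have hUV : ∀ i ∈ U, ∀ j : Fin 3, i ≠ j → j ∈ Finset.univ := fun _ _ _ _ => Finset.mem_univ _
  have h2 := T.expect_part hUV triangle (fun _ => (0 : Fin 1)) (fun _ => (0 : Fin 1))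
    (fun _ _ _ _ => rfl) (fun i _ => y i) φ
  rw [T.expect_part hUV G v s h x φ, h2]
  congr 1
  funext i w
  exact hxy i (mem_of_partAgent w)

/-! ### The inequality from the hexagon. -/

/-- The copy of source `j` from which copy `v` of party `i` is fed in the hexagon. -/
def hexagonSource (i : Fin 3) (v : Fin 2) (j : Fin 3) : Fin 2 :=
  if i = 0 ∧ j = 1 then v + 1 else v

/-- An agent of the hexagon, with its two sources. -/
def hexagonAgent (i : Fin 3) (v : Fin 2) :
    (part {i} {i}ᶜ (by simp [eq_comm])).Embedding hexagon :=
  partEmbedding _ hexagon (fun _ => v) (fun j => hexagonSource i v j) (by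
    intro k hk j hij
    rw [Finset.mem_singleton] at hk
    subst hk
    rfl)

/-- The part around an agent of party `i` contains no copy of source `i`, so only the sources
feeding both parties have to be compared. -/
lemma hexagonAgent_disjoint {i k : Fin 3} {v w : Fin 2}
    (h : ∀ j, j ≠ i → j ≠ k → hexagonSource i v j ≠ hexagonSource k w j) :
    (hexagonAgent i v).Disjoint (hexagonAgent k w) := by
  intro j s₁ s₂
  refine h j ?_ ?_
  · rintro rfl
    have := s₁.isLt
    simp [part] at this
  · rintro rfl
    have := s₂.isLt
    simp [part] at this

variable (z : ∀ i, X i) (n : ∀ i, A i → ℝ)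

/-- The expectation of an observable of a party in the triangle. -/
def mean (i : Fin 3) : ℝ := T.expect triangle (fun i _ => z i) (fun a => n i (a i (0 : Fin 1)))

/-- The part consisting of one agent and only its own two sources also embeds in the triangle. The
absence of the third source is what lets the same part serve for independence. -/
lemma expect_hexagonAgent (i : Fin 3) (v : Fin 2) :
    T.expect _ ((hexagonAgent i v).restrict fun i _ => z i)
      (fun b => n i (b i (partAgent _ i (Finset.mem_singleton_self i)))) = T.mean z n i := by
  have hUV : ∀ k ∈ ({i} : Finset (Fin 3)), ∀ j, k ≠ j → j ∈ ({i}ᶜ : Finset (Fin 3)) := by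
    simp [eq_comm]
  exact (T.expect_part hUV triangle (fun _ => (0 : Fin 1)) (fun _ => (0 : Fin 1))
    (fun _ _ _ _ => rfl) (fun i _ => z i) (fun b => n i (b i (Finset.mem_singleton_self i)))).symm

lemma hexagon_mean (i : Fin 3) (v : Fin 2) :
    T.expect hexagon (fun i _ => z i) (fun a => n i (a i v)) = T.mean z n i := by
  rw [← T.expect_hexagonAgent z n i v]
  exact T.expect_restrict (hexagonAgent i v) _
    (fun b => n i (b i (partAgent _ i (Finset.mem_singleton_self i))))

lemma hexagon_mul {i k : Fin 3} {v w : Fin 2}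
    (h : ∀ j, j ≠ i → j ≠ k → hexagonSource i v j ≠ hexagonSource k w j) :
    T.expect hexagon (fun i _ => z i) (fun a => n i (a i v) * n k (a k w)) =
      T.mean z n i * T.mean z n k := by
  rw [← T.expect_hexagonAgent z n i v, ← T.expect_hexagonAgent z n k w]
  exact T.expect_mul (hexagonAgent i v) (hexagonAgent k w) (hexagonAgent_disjoint h) _
    (fun b => n i (b i (partAgent _ i (Finset.mem_singleton_self i))))
    (fun b => n k (b k (partAgent _ k (Finset.mem_singleton_self k))))

lemma hexagon_mul_mul {i k l : Fin 3} {u v w : Fin 2}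
    (h₁₂ : ∀ j, j ≠ i → j ≠ k → hexagonSource i u j ≠ hexagonSource k v j)
    (h₁₃ : ∀ j, j ≠ i → j ≠ l → hexagonSource i u j ≠ hexagonSource l w j)
    (h₂₃ : ∀ j, j ≠ k → j ≠ l → hexagonSource k v j ≠ hexagonSource l w j) :
    T.expect hexagon (fun i _ => z i) (fun a => n i (a i u) * (n k (a k v) * n l (a l w))) =
      T.mean z n i * (T.mean z n k * T.mean z n l) := by
  rw [← T.expect_hexagonAgent z n i u, ← T.expect_hexagonAgent z n k v,
    ← T.expect_hexagonAgent z n l w]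
  exact T.expect_mul_mul (hexagonAgent i u) (hexagonAgent k v) (hexagonAgent l w)
    (hexagonAgent_disjoint h₁₂) (hexagonAgent_disjoint h₁₃) (hexagonAgent_disjoint h₂₃) _
    (fun b => n i (b i (partAgent _ i (Finset.mem_singleton_self i))))
    (fun b => n k (b k (partAgent _ k (Finset.mem_singleton_self k))))
    (fun b => n l (b l (partAgent _ l (Finset.mem_singleton_self l))))

/-- Neighbours in the hexagon behave as in the triangle. -/
lemma hexagon_neighbours {i k : Fin 3} (o : Fin 3) (v : Fin 3 → Fin 2) (s : Fin 3 → Fin 2)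
    (hi : i ≠ o) (hk : k ≠ o)
    (h : ∀ l, l ≠ o → ∀ j, l ≠ j → hexagonSource l (v l) j = s j) :
    T.expect hexagon (fun i _ => z i) (fun a => n i (a i (v i)) * n k (a k (v k))) =
      T.expect triangle (fun i _ => z i) (fun a => n i (a i (0 : Fin 1)) * n k (a k (0 : Fin 1))) :=
  T.expect_eq_triangle {o}ᶜ hexagon v s
    (fun l hl j hlj => h l (by simpa using hl) j hlj) (fun i _ => z i) z (fun _ _ => rfl)
    (fun b => n i (b i (by simpa using hi)) * n k (b k (by simpa using hk)))

/-- If no two parties ever obtain the outcome marked by `n` together, then inclusion-exclusion in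
the hexagon bounds the probability that nobody obtains it. -/
theorem mean_inequality (hn : ∀ i a, n i a = 0 ∨ n i a = 1)
    (h01 : T.expect triangle (fun i _ => z i)
      (fun a => n 0 (a 0 (0 : Fin 1)) * n 1 (a 1 (0 : Fin 1))) = 0)
    (h12 : T.expect triangle (fun i _ => z i)
      (fun a => n 1 (a 1 (0 : Fin 1)) * n 2 (a 2 (0 : Fin 1))) = 0)
    (h20 : T.expect triangle (fun i _ => z i)
      (fun a => n 2 (a 2 (0 : Fin 1)) * n 0 (a 0 (0 : Fin 1))) = 0) :
    2 * (T.mean z n 0 * (T.mean z n 1 * T.mean z n 2)) ≤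
      (1 - T.mean z n 0 - T.mean z n 1 - T.mean z n 2) ^ 2 := by
  let N : Fin 3 → Fin 2 → hexagon.Labelling A → ℝ := fun i v a => n i (a i v)
  -- If `m` agents are marked, this says that `(m - 1) * (m - 2) / 2` is at least the number of
  -- fully marked alternating triples of the ring. The pairs on the right are all 15; the last six
  -- products but none of the others are neighbours.
  have key : ∀ a : hexagon.Labelling A,
      N 0 0 a + N 0 1 a + N 1 0 a + N 1 1 a + N 2 0 a + N 2 1 a
        + N 0 0 a * (N 2 0 a * N 1 1 a) + N 1 0 a * (N 0 1 a * N 2 1 a) ≤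
      1 + N 0 0 a * N 2 0 a + N 0 0 a * N 1 1 a + N 2 0 a * N 1 1 a
        + N 1 0 a * N 0 1 a + N 1 0 a * N 2 1 a + N 0 1 a * N 2 1 a
        + N 0 0 a * N 0 1 a + N 1 0 a * N 1 1 a + N 2 0 a * N 2 1 a
        + N 0 0 a * N 1 0 a + N 1 0 a * N 2 0 a + N 2 0 a * N 0 1 a
        + N 0 1 a * N 1 1 a + N 1 1 a * N 2 1 a + N 2 1 a * N 0 0 a := by
    intro a
    rcases hn 0 (a 0 (0 : Fin 2)) with h1 | h1 <;> rcases hn 0 (a 0 (1 : Fin 2)) with h2 | h2 <;>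
    rcases hn 1 (a 1 (0 : Fin 2)) with h3 | h3 <;> rcases hn 1 (a 1 (1 : Fin 2)) with h4 | h4 <;>
    rcases hn 2 (a 2 (0 : Fin 2)) with h5 | h5 <;> rcases hn 2 (a 2 (1 : Fin 2)) with h6 | h6 <;>
    simp only [N, h1, h2, h3, h4, h5, h6] <;> norm_num
  have e0 : T.expect hexagon (fun i _ => z i) (fun a => N 0 0 a * N 1 0 a) = 0 :=
    (T.hexagon_neighbours z n (i := 0) (k := 1) 2 ![0, 0, 0] ![0, 1, 0]
      (by decide) (by decide) (by decide)).trans h01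
  have e1 : T.expect hexagon (fun i _ => z i) (fun a => N 1 0 a * N 2 0 a) = 0 :=
    (T.hexagon_neighbours z n (i := 1) (k := 2) 0 ![0, 0, 0] ![0, 0, 0]
      (by decide) (by decide) (by decide)).trans h12
  have e2 : T.expect hexagon (fun i _ => z i) (fun a => N 2 0 a * N 0 1 a) = 0 :=
    (T.hexagon_neighbours z n (i := 2) (k := 0) 1 ![1, 0, 0] ![0, 0, 1]
      (by decide) (by decide) (by decide)).trans h20
  have e3 : T.expect hexagon (fun i _ => z i) (fun a => N 0 1 a * N 1 1 a) = 0 :=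
    (T.hexagon_neighbours z n (i := 0) (k := 1) 2 ![1, 1, 0] ![1, 0, 1]
      (by decide) (by decide) (by decide)).trans h01
  have e4 : T.expect hexagon (fun i _ => z i) (fun a => N 1 1 a * N 2 1 a) = 0 :=
    (T.hexagon_neighbours z n (i := 1) (k := 2) 0 ![0, 1, 1] ![1, 1, 1]
      (by decide) (by decide) (by decide)).trans h12
  have e5 : T.expect hexagon (fun i _ => z i) (fun a => N 2 1 a * N 0 0 a) = 0 :=
    (T.hexagon_neighbours z n (i := 2) (k := 0) 1 ![0, 0, 1] ![1, 1, 0]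
      (by decide) (by decide) (by decide)).trans h20
  have := T.expect_mono hexagon (fun i _ => z i) key
  simp only [expect_add, expect_const] at this
  simp only [N] at this e0 e1 e2 e3 e4 e5
  rw [T.hexagon_mean, T.hexagon_mean, T.hexagon_mean, T.hexagon_mean, T.hexagon_mean,
    T.hexagon_mean,
    T.hexagon_mul_mul z n (i := 0) (k := 2) (l := 1) (u := 0) (v := 0) (w := 1)
      (by decide) (by decide) (by decide),
    T.hexagon_mul_mul z n (i := 1) (k := 0) (l := 2) (u := 0) (v := 1) (w := 1)
      (by decide) (by decide) (by decide),
    T.hexagon_mul z n (i := 0) (k := 2) (v := 0) (w := 0) (by decide),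
    T.hexagon_mul z n (i := 0) (k := 1) (v := 0) (w := 1) (by decide),
    T.hexagon_mul z n (i := 2) (k := 1) (v := 0) (w := 1) (by decide),
    T.hexagon_mul z n (i := 1) (k := 0) (v := 0) (w := 1) (by decide),
    T.hexagon_mul z n (i := 1) (k := 2) (v := 0) (w := 1) (by decide),
    T.hexagon_mul z n (i := 0) (k := 2) (v := 1) (w := 1) (by decide),
    T.hexagon_mul z n (i := 0) (k := 0) (v := 0) (w := 1) (by decide),
    T.hexagon_mul z n (i := 1) (k := 1) (v := 0) (w := 1) (by decide),
    T.hexagon_mul z n (i := 2) (k := 2) (v := 0) (w := 1) (by decide),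
    e0, e1, e2, e3, e4, e5] at this
  nlinarith [this]

end TriangleTheory

open Setup

/-! ### Consequences for triangle correlations. -/

section TriangleCorrelation

variable {X A : Fin 3 → Type} [∀ i, Fintype (A i)] [∀ i, DecidableEq (A i)]

lemma TriangleTheory.expect_triangle (T : TriangleTheory X A) {Q : Behaviour X A}
    (hQ : ∀ x a, T.prob Setup.triangle (fun i _ => x i) (fun i _ => a i) = Q x a)
    (x : ∀ i, X i) (φ : (∀ i, A i) → ℝ) :
    T.expect triangle (fun i _ => x i) (fun a => φ fun i => a i (0 : Fin 1)) =
      ∑ a, Q x a * φ a := by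
  let e : triangle.Labelling A ≃ (∀ i, A i) :=
    { toFun a i := a i (0 : Fin 1)
      invFun a i _ := a i
      left_inv a := by
        funext i v
        exact congrArg (a i) (Subsingleton.elim (0 : Fin 1) v)
      right_inv a := rfl }
  refine Fintype.sum_equiv e _ _ fun a => ?_
  rw [← hQ]
  congr 2
  exact (e.left_inv a).symm

variable {Q : Behaviour X A}

lemma IsTriangleCorrelation.nonneg (hQ : IsTriangleCorrelation Q) (x : ∀ i, X i) (a : ∀ i, A i) :
    0 ≤ Q x a := by
  obtain ⟨T, hT⟩ := hQ
  rw [← hT]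
  exact T.nonneg _ _ _

lemma IsTriangleCorrelation.sum_eq_one (hQ : IsTriangleCorrelation Q) (x : ∀ i, X i) :
    ∑ a, Q x a = 1 := by
  obtain ⟨T, hT⟩ := hQ
  have := T.expect_triangle hT x (fun _ => 1)
  rw [T.expect_const] at this
  simpa using this.symm

/-- The behaviour of two parties does not depend on the input of the third one. -/
lemma IsTriangleCorrelation.pair_nonsignalling (hQ : IsTriangleCorrelation Q) {i k o : Fin 3}
    (hi : i ≠ o) (hk : k ≠ o) (x x' : ∀ i, X i) (hx : ∀ l, l ≠ o → x l = x' l)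
    (φ : A i → A k → ℝ) :
    ∑ a, Q x a * φ (a i) (a k) = ∑ a, Q x' a * φ (a i) (a k) := by
  obtain ⟨T, hT⟩ := hQ
  rw [← T.expect_triangle hT x (fun a => φ (a i) (a k)),
    ← T.expect_triangle hT x' (fun a => φ (a i) (a k))]
  exact T.expect_eq_triangle {o}ᶜ triangle (fun _ => (0 : Fin 1)) (fun _ => (0 : Fin 1))
    (fun _ _ _ _ => rfl) (fun l _ => x l) x' (fun l hl => hx l (by simpa using hl))
    (fun b => φ (b i (by simpa using hi)) (b k (by simpa using hk)))

lemma IsTriangleCorrelation.mean_inequality (hQ : IsTriangleCorrelation Q) (z : ∀ i, X i)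
    (n : ∀ i, A i → ℝ) (hn : ∀ i a, n i a = 0 ∨ n i a = 1)
    (h01 : ∑ a, Q z a * (n 0 (a 0) * n 1 (a 1)) = 0)
    (h12 : ∑ a, Q z a * (n 1 (a 1) * n 2 (a 2)) = 0)
    (h20 : ∑ a, Q z a * (n 2 (a 2) * n 0 (a 0)) = 0) :
    2 * ((∑ a, Q z a * n 0 (a 0)) * ((∑ a, Q z a * n 1 (a 1)) * ∑ a, Q z a * n 2 (a 2))) ≤
      (1 - (∑ a, Q z a * n 0 (a 0)) - (∑ a, Q z a * n 1 (a 1)) - ∑ a, Q z a * n 2 (a 2)) ^ 2 := by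
  obtain ⟨T, hT⟩ := hQ
  rw [← T.expect_triangle hT z (fun a => n 0 (a 0)), ← T.expect_triangle hT z (fun a => n 1 (a 1)),
    ← T.expect_triangle hT z (fun a => n 2 (a 2))]
  rw [← T.expect_triangle hT z (fun a => n 0 (a 0) * n 1 (a 1))] at h01
  rw [← T.expect_triangle hT z (fun a => n 1 (a 1) * n 2 (a 2))] at h12
  rw [← T.expect_triangle hT z (fun a => n 2 (a 2) * n 0 (a 0))] at h20
  exact T.mean_inequality z n hn h01 h12 h20

end TriangleCorrelation

/-! ### The chained Bell inequality. -/

/-- Gives `u` to party `i`, `v` to the next party and `w` to the third one. -/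
def cyc {α : Type} (i : Fin 3) (u v w : α) : Fin 3 → α :=
  fun k => if k = i then u else if k = i + 1 then v else w

@[simp] lemma cyc_self {α : Type} (i : Fin 3) (u v w : α) : cyc i u v w i = u := by simp [cyc]

@[simp] lemma cyc_add_one {α : Type} (i : Fin 3) (u v w : α) : cyc i u v w (i + 1) = v := by
  simp [cyc]

@[simp] lemma cyc_add_two {α : Type} (i : Fin 3) (u v w : α) : cyc i u v w (i + 2) = w := by
  simp [cyc]

lemma cyc_same {α : Type} (i : Fin 3) (u : α) : cyc i u u u = fun _ => u := by
  funext k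
  simp [cyc]

lemma cyc_congr_left {α : Type} {i l : Fin 3} (h : l ≠ i) (u u' v w : α) :
    cyc i u v w l = cyc i u' v w l := by
  simp [cyc, h]

lemma cyc_congr_right {α : Type} {i l : Fin 3} (h : l ≠ i + 1) (u v v' w : α) :
    cyc i u v w l = cyc i u v' w l := by
  simp [cyc, h]

lemma sum_cyc (i : Fin 3) (f : (Fin 3 → Fin 2) → ℝ) :
    ∑ a, f a = ∑ u, ∑ v, ∑ w, f (cyc i u v w) := by
  have h : Function.Bijective fun t : Fin 2 × Fin 2 × Fin 2 => cyc i t.1 t.2.1 t.2.2 := by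
    revert i
    decide
  rw [← h.sum_comp f, Fintype.sum_prod_type]
  refine Finset.sum_congr rfl fun u _ => ?_
  rw [Fintype.sum_prod_type]

/-- Tripartite behaviours with five inputs and two outcomes for every party. -/
abbrev FiveInputBehaviour : Type := Behaviour (fun _ => Fin 5) (fun _ => Fin 2)

/-- The behaviour of the parties `i` and `i + 1` together with the outcome `0` of the third party
on input `0`. -/
def FiveInputBehaviour.cond (Q : FiveInputBehaviour) (i : Fin 3) (α β : Fin 5) (u v : Fin 2) : ℝ :=
  Q (cyc i α β 0) (cyc i u v 0)

/-- The chained Bell expression with five links. -/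
def chainedBell (q : Fin 5 → Fin 5 → Fin 2 → Fin 2 → ℝ) : ℝ :=
  (q 0 1 0 0 + q 0 1 1 1) + (q 2 1 0 0 + q 2 1 1 1) + (q 2 3 0 0 + q 2 3 1 1) +
    (q 4 3 0 0 + q 4 3 1 1) + (q 4 0 0 1 + q 4 0 1 0)

lemma chainedBell_nonneg {q : Fin 5 → Fin 5 → Fin 2 → Fin 2 → ℝ} (hq : ∀ α β u v, 0 ≤ q α β u v) :
    0 ≤ chainedBell q := by
  unfold chainedBell
  have := hq 0 1 0 0
  have := hq 0 1 1 1
  have := hq 2 1 0 0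
  have := hq 2 1 1 1
  have := hq 2 3 0 0
  have := hq 2 3 1 1
  have := hq 4 3 0 0
  have := hq 4 3 1 1
  have := hq 4 0 0 1
  have := hq 4 0 1 0
  linarith

/-- The chained Bell inequality for a nonsignalling behaviour in which one of the two pairs of
opposite outcomes is impossible for the inputs `0`. -/
lemma le_chainedBell {q : Fin 5 → Fin 5 → Fin 2 → Fin 2 → ℝ} (hq : ∀ α β u v, 0 ≤ q α β u v)
    (left : ∀ α β β' u, q α β u 0 + q α β u 1 = q α β' u 0 + q α β' u 1)
    (right : ∀ α α' β v, q α β 0 v + q α β 1 v = q α' β 0 v + q α' β 1 v)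
    (hdet : q 0 0 1 0 = 0 ∨ q 0 0 0 1 = 0) :
    q 0 0 1 0 + q 0 0 0 1 ≤ chainedBell q := by
  unfold chainedBell
  have := hq 0 1 0 0
  have := hq 0 1 1 1
  have := hq 2 1 0 0
  have := hq 2 1 1 1
  have := hq 2 3 0 0
  have := hq 2 3 1 1
  have := hq 4 3 0 0
  have := hq 4 3 1 1
  have := hq 4 0 0 1
  have := hq 4 0 1 0
  -- Follow the marginals along A0, B1, A2, B3, A4, B0. Each link bounds the change of marginal, up
  -- to a flip of the outcome on the first four, by its own term; the flips cancel in pairs.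
  have := left 0 0 1 0
  have := left 0 0 1 1
  have := right 0 2 1 0
  have := right 0 2 1 1
  have := left 2 1 3 0
  have := left 2 1 3 1
  have := right 2 4 3 0
  have := right 2 4 3 1
  have := left 4 3 0 0
  have := left 4 3 0 1
  have := right 4 0 0 0
  have := right 4 0 0 1
  -- In general `q 0 0 1 0 - q 0 0 0 1` is the difference of the marginals of A0 and B0; `hdet`
  -- turns its absolute value into the sum.
  rcases hdet with h | h <;> linarith

namespace IsTriangleCorrelation

variable {Q : FiveInputBehaviour} (hQ : IsTriangleCorrelation Q)
include hQ

lemma cond_left (i : Fin 3) (α β β' : Fin 5) (u : Fin 2) :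
    Q.cond i α β u 0 + Q.cond i α β u 1 = Q.cond i α β' u 0 + Q.cond i α β' u 1 := by
  have := hQ.pair_nonsignalling (i := i) (k := i + 2) (o := i + 1) (by simp) (by simp)
    (cyc i α β 0) (cyc i α β' 0) (fun l hl => cyc_congr_right hl _ _ _ _)
    (fun a c => if a = u ∧ c = 0 then 1 else 0)
  rw [sum_cyc i, sum_cyc i] at this
  fin_cases u <;> simpa [FiveInputBehaviour.cond, Fin.sum_univ_two] using this

lemma cond_right (i : Fin 3) (α α' β : Fin 5) (v : Fin 2) :
    Q.cond i α β 0 v + Q.cond i α β 1 v = Q.cond i α' β 0 v + Q.cond i α' β 1 v := by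
  have := hQ.pair_nonsignalling (i := i + 1) (k := i + 2) (o := i) (by simp) (by simp)
    (cyc i α β 0) (cyc i α' β 0) (fun l hl => cyc_congr_left hl _ _ _ _)
    (fun a c => if a = v ∧ c = 0 then 1 else 0)
  rw [sum_cyc i, sum_cyc i] at this
  fin_cases v <;> simpa [FiveInputBehaviour.cond, Fin.sum_univ_two] using this

/-- In a triangle correlation in which exactly one party obtains `1` on the inputs `0`, the chained
Bell inequality cannot be strongly violated by all pairs of parties. -/
theorem one_le_chainedBell
    (h : ∀ a : Fin 3 → Fin 2, (∀ i, a ≠ Pi.single i 1) → Q (fun _ => 0) a = 0) :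
    1 ≤ ∑ i, chainedBell (Q.cond i) := by
  let t : Fin 3 → ℝ := fun i => Q (fun _ => 0) (Pi.single i 1)
  have h000 : Q (fun _ => 0) (cyc 0 0 0 0) = 0 := h _ (by decide)
  have h011 : Q (fun _ => 0) (cyc 0 0 1 1) = 0 := h _ (by decide)
  have h101 : Q (fun _ => 0) (cyc 0 1 0 1) = 0 := h _ (by decide)
  have h110 : Q (fun _ => 0) (cyc 0 1 1 0) = 0 := h _ (by decide)
  have h111 : Q (fun _ => 0) (cyc 0 1 1 1) = 0 := h _ (by decide)
  have e0 : cyc 0 1 0 0 = (Pi.single 0 1 : Fin 3 → Fin 2) := by decide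
  have e1 : cyc 0 0 1 0 = (Pi.single 1 1 : Fin 3 → Fin 2) := by decide
  have e2 : cyc 0 0 0 1 = (Pi.single 2 1 : Fin 3 → Fin 2) := by decide
  have hsum (φ : (Fin 3 → Fin 2) → ℝ) : ∑ a, Q (fun _ => 0) a * φ a =
      t 0 * φ (Pi.single 0 1) + t 1 * φ (Pi.single 1 1) + t 2 * φ (Pi.single 2 1) := by
    rw [sum_cyc 0]
    simp only [Fin.sum_univ_two, h000, h011, h101, h110, h111, e0, e1, e2, t]
    ring
  have htot : t 0 + t 1 + t 2 = 1 := by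
    have := hsum fun _ => 1
    simp only [mul_one] at this
    rw [← this, hQ.sum_eq_one]
  -- The right-hand side of `mean_inequality` vanishes because the `t i` sum to 1.
  have hprod : t 0 * (t 1 * t 2) ≤ 0 := by
    have := hQ.mean_inequality (fun _ => 0) (fun _ a => if a = 1 then 1 else 0)
      (fun i a => by split_ifs <;> simp)
      (by rw [hsum fun a => (if a 0 = 1 then 1 else 0) * (if a 1 = 1 then 1 else 0)]; simp)
      (by rw [hsum fun a => (if a 1 = 1 then 1 else 0) * (if a 2 = 1 then 1 else 0)]; simp)
      (by rw [hsum fun a => (if a 2 = 1 then 1 else 0) * (if a 0 = 1 then 1 else 0)]; simp)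
    rw [hsum fun a => if a 0 = 1 then 1 else 0, hsum fun a => if a 1 = 1 then 1 else 0,
      hsum fun a => if a 2 = 1 then 1 else 0] at this
    simp at this
    have h0 : 1 - t 0 - t 1 - t 2 = 0 := by linarith
    rw [h0] at this
    linarith
  have ht : ∀ i, 0 ≤ t i := fun i => hQ.nonneg _ _
  have hzero : t 0 = 0 ∨ t 1 = 0 ∨ t 2 = 0 := by
    have : t 0 * (t 1 * t 2) = 0 :=
      le_antisymm hprod (mul_nonneg (ht 0) (mul_nonneg (ht 1) (ht 2)))
    simpa using this
  have hq : ∀ i α β u v, 0 ≤ Q.cond i α β u v := fun i α β u v => hQ.nonneg _ _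
  have single_left : ∀ i, cyc i 1 0 0 = (Pi.single i 1 : Fin 3 → Fin 2) := by decide
  have single_right : ∀ i, cyc i 0 1 0 = (Pi.single (i + 1) 1 : Fin 3 → Fin 2) := by decide
  have hbell : ∀ i, t i = 0 ∨ t (i + 1) = 0 → t i + t (i + 1) ≤ chainedBell (Q.cond i) := by
    intro i hi
    have h10 : Q.cond i 0 0 1 0 = t i := by
      simp only [FiveInputBehaviour.cond, cyc_same, single_left, t]
    have h01 : Q.cond i 0 0 0 1 = t (i + 1) := by
      simp only [FiveInputBehaviour.cond, cyc_same, single_right, t]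
    rw [← h10, ← h01]
    exact le_chainedBell (hq i) (hQ.cond_left i) (hQ.cond_right i) (by rwa [h10, h01])
  rw [Fin.sum_univ_three]
  have b0 := chainedBell_nonneg (hq 0)
  have b1 := chainedBell_nonneg (hq 1)
  have b2 := chainedBell_nonneg (hq 2)
  have c0 : t 0 = 0 ∨ t 1 = 0 → t 0 + t 1 ≤ _ := hbell 0
  have c1 : t 1 = 0 ∨ t 2 = 0 → t 1 + t 2 ≤ _ := hbell 1
  have c2 : t 2 = 0 ∨ t 0 = 0 → t 2 + t 0 ≤ _ := hbell 2
  -- The two pairs containing the party with `t i = 0` already contribute 1; the third pair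
  -- contributes at least 0.
  rcases hzero with h0 | h0 | h0
  · linarith [c0 (.inl h0), c2 (.inr h0)]
  · linarith [c0 (.inr h0), c1 (.inl h0)]
  · linarith [c1 (.inr h0), c2 (.inl h0)]

end IsTriangleCorrelation

/-! ### Shared randomness. -/

open MeasureTheory in
/-- The bound of `IsTriangleCorrelation.one_le_chainedBell` survives shared randomness. -/
theorem IsBipartiteWithSharedRandomness.one_le_chainedBell {P : FiveInputBehaviour}
    (hP : IsBipartiteWithSharedRandomness P)
    (h : ∀ a : Fin 3 → Fin 2, (∀ i, a ≠ Pi.single i 1) → P (fun _ => 0) a = 0) :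
    1 ≤ ∑ i, chainedBell (P.cond i) := by
  obtain ⟨Ω, _, μ, Q, hμ, hQ, hmeas, hPQ⟩ := hP
  have hint : ∀ x a, Integrable (fun ω => Q ω x a) μ := by
    intro x a
    refine Integrable.of_bound (hmeas x a).aestronglyMeasurable 1 (.of_forall fun ω => ?_)
    rw [Real.norm_of_nonneg ((hQ ω).nonneg x a), ← (hQ ω).sum_eq_one x]
    exact Finset.single_le_sum (fun b _ => (hQ ω).nonneg x b) (Finset.mem_univ a)
  -- A nonnegative function with zero integral vanishes almost everywhere, so almost every `Q ω`
  -- inherits the zeros of `P`.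
  have hae : ∀ᵐ ω ∂μ, ∀ a : Fin 3 → Fin 2, (∀ i, a ≠ Pi.single i 1) → Q ω (fun _ => 0) a = 0 := by
    rw [ae_all_iff]
    intro a
    by_cases ha : ∀ i, a ≠ Pi.single i 1
    · have h0 := h a ha
      rw [hPQ, integral_eq_zero_iff_of_nonneg (fun ω => (hQ ω).nonneg _ _) (hint _ _)] at h0
      filter_upwards [h0] with ω hω _ using hω
    · exact .of_forall fun ω h' => absurd h' ha
  have hcond : ∀ i α β u v, P.cond i α β u v = ∫ ω, FiveInputBehaviour.cond (Q ω) i α β u v ∂μ :=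
    fun i α β u v => hPQ _ _
  have hi : ∀ i α β u v, Integrable (fun ω => FiveInputBehaviour.cond (Q ω) i α β u v) μ :=
    fun i α β u v => hint _ _
  have hbell : ∀ i, Integrable (fun ω => chainedBell (FiveInputBehaviour.cond (Q ω) i)) μ := by
    intro i
    unfold chainedBell
    fun_prop
  have hP_bell : ∀ i,
      chainedBell (P.cond i) = ∫ ω, chainedBell (FiveInputBehaviour.cond (Q ω) i) ∂μ := by
    intro i
    simp only [chainedBell, hcond]
    repeat rw [integral_add]
    all_goals fun_prop
  calc (1 : ℝ) = ∫ _, 1 ∂μ := by simp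
    _ ≤ ∫ ω, ∑ i, chainedBell (FiveInputBehaviour.cond (Q ω) i) ∂μ := by
      refine integral_mono_ae (integrable_const _)
        (integrable_finsetSum _ fun i _ => hbell i) ?_
      filter_upwards [hae] with ω hω using (hQ ω).one_le_chainedBell hω
    _ = ∑ i, chainedBell (P.cond i) := by
      rw [integral_finsetSum _ fun i _ => hbell i]
      exact Finset.sum_congr rfl fun i _ => (hP_bell i).symm

/-! ### The Born rule is nonsignalling. -/

open Matrix

section Born

lemma tensorOp_mul (E F : Fin 3 → Matrix (Fin 2) (Fin 2) ℂ) :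
    tensorOp (fun i => E i * F i) = tensorOp E * tensorOp F := by
  ext s t
  simp only [tensorOp, Matrix.of_apply, Matrix.mul_apply, ← Finset.prod_mul_distrib]
  rw [Finset.prod_univ_sum, Fintype.piFinset_univ]

lemma tensorOp_conjTranspose (E : Fin 3 → Matrix (Fin 2) (Fin 2) ℂ) :
    tensorOp (fun i => (E i)ᴴ) = (tensorOp E)ᴴ := by
  ext s t
  simp [tensorOp, Matrix.conjTranspose_apply]

open scoped MatrixOrder Matrix.Norms.L2Operator in
lemma tensorOp_posSemidef {E : Fin 3 → Matrix (Fin 2) (Fin 2) ℂ} (hE : ∀ i, (E i).PosSemidef) :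
    (tensorOp E).PosSemidef := by
  have h : ∀ i, ∃ B : Matrix (Fin 2) (Fin 2) ℂ, E i = Bᴴ * B := fun i =>
    CStarAlgebra.nonneg_iff_eq_star_mul_self.mp (hE i).nonneg
  choose B hB using h
  obtain rfl : E = fun i => (B i)ᴴ * B i := funext hB
  rw [tensorOp_mul, tensorOp_conjTranspose]
  exact Matrix.posSemidef_conjTranspose_mul_self _

variable {X A : Fin 3 → Type} [∀ i, Fintype (A i)] [∀ i, DecidableEq (A i)]

/-- The operator of a group of parties: parties outside of `S` are traced over all outcomes. -/
lemma sum_tensorOp (M : ∀ i, X i → QubitMeasurement (A i)) (S : Finset (Fin 3)) (x : ∀ i, X i)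
    (b : ∀ i, A i) :
    ∑ a : (∀ i, A i) with (∀ i ∈ S, a i = b i), tensorOp (fun i => (M i (x i)).effect (a i)) =
      tensorOp (fun i => if i ∈ S then (M i (x i)).effect (b i) else 1) := by
  have hset : ({a | ∀ i ∈ S, a i = b i} : Finset (∀ i, A i)) =
      Fintype.piFinset fun i => if i ∈ S then {b i} else Finset.univ := by
    ext a
    simp only [Finset.mem_filter, Finset.mem_univ, true_and, Fintype.mem_piFinset]
    refine forall_congr' fun i => ?_
    by_cases hi : i ∈ S <;> simp [hi]
  ext s t
  rw [hset, Matrix.sum_apply]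
  simp only [tensorOp, Matrix.of_apply]
  rw [← Finset.prod_univ_sum (fun i => if i ∈ S then {b i} else Finset.univ)
    (fun i o => (M i (x i)).effect o (s i) (t i))]
  refine Finset.prod_congr rfl fun i _ => ?_
  by_cases hi : i ∈ S
  · simp [hi]
  · simp only [hi, if_false]
    rw [← Matrix.sum_apply, (M i (x i)).sum_eq_one]

lemma sum_bornBehaviour (ψ : (Fin 3 → Fin 2) → ℂ) (M : ∀ i, X i → QubitMeasurement (A i))
    (S : Finset (Fin 3)) (x : ∀ i, X i) (b : ∀ i, A i) :
    ∑ a with (∀ i ∈ S, a i = b i), bornBehaviour ψ M x a =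
      (star ψ ⬝ᵥ
        (tensorOp fun i => if i ∈ S then (M i (x i)).effect (b i) else 1).mulVec ψ).re := by
  rw [← sum_tensorOp, Matrix.sum_mulVec, dotProduct_sum, Complex.re_sum]
  rfl

lemma tensorOp_one : tensorOp (fun _ => 1) = 1 := by
  ext s t
  simp only [tensorOp, Matrix.of_apply, Matrix.one_apply]
  rw [Finset.prod_ite_zero]
  simp [funext_iff]

/-- The Born rule gives nonsignalling correlations. -/
theorem isNonsignalling_bornBehaviour {ψ : (Fin 3 → Fin 2) → ℂ} (hψ : star ψ ⬝ᵥ ψ = 1)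
    (M : ∀ i, X i → QubitMeasurement (A i)) : IsNonsignalling (bornBehaviour ψ M) where
  nonneg x a :=
    (Complex.nonneg_iff.mp ((tensorOp_posSemidef fun i =>
      (M i (x i)).posSemidef (a i)).dotProduct_mulVec_nonneg ψ)).1
  sum_eq_one x := by
    by_cases hA : Nonempty (∀ i, A i)
    · obtain ⟨b⟩ := hA
      have := sum_bornBehaviour ψ M ∅ x b
      simpa [tensorOp_one, hψ] using this
    -- Without outcomes the effects would sum to 0 instead of 1.
    · exfalso
      obtain ⟨i, hi⟩ : ∃ i, IsEmpty (A i) := by simpa using hA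
      have := congrFun (congrFun (M i (x i)).sum_eq_one 0) 0
      simp at this
  nonsignalling S x x' h b := by
    rw [sum_bornBehaviour, sum_bornBehaviour]
    congr 4
    funext i
    by_cases hi : i ∈ S
    · rw [if_pos hi, if_pos hi, h i hi]
    · rw [if_neg hi, if_neg hi]

end Born

/-! ### Measurements on the W state. -/

/-- The matrix of the outcome of sign `e` of the measurement of `c Z + s X`. -/
noncomputable def projector (c s e : ℝ) : Matrix (Fin 2) (Fin 2) ℂ :=
  !![(((1 + e * c) / 2 : ℝ) : ℂ), ((e * s / 2 : ℝ) : ℂ);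
    ((e * s / 2 : ℝ) : ℂ), (((1 - e * c) / 2 : ℝ) : ℂ)]

lemma projector_posSemidef {c s e : ℝ} (h : c ^ 2 + s ^ 2 = 1) (he : e ^ 2 = 1) :
    (projector c s e).PosSemidef := by
  have : projector c s e = (projector c s e)ᴴ * projector c s e := by
    ext i j
    fin_cases i <;> fin_cases j <;>
      simp only [projector, Matrix.mul_apply, Matrix.conjTranspose_apply, Fin.sum_univ_two] <;>
      simp [-Complex.ofReal_div, -Complex.ofReal_mul, -Complex.ofReal_add, -Complex.ofReal_sub] <;>
      norm_cast <;> nlinarith [h, he]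
  rw [this]
  exact Matrix.posSemidef_conjTranspose_mul_self _

/-- The sign of an outcome. -/
def outcomeSign (o : Fin 2) : ℝ := if o = 0 then 1 else -1

/-- The measurement of `c Z + s X`. -/
noncomputable def blochMeasurement (c s : ℝ) (h : c ^ 2 + s ^ 2 = 1) :
    QubitMeasurement (Fin 2) where
  effect o := projector c s (outcomeSign o)
  posSemidef o := projector_posSemidef h (by unfold outcomeSign; split_ifs <;> norm_num)
  sum_eq_one := by
    ext i j
    fin_cases i <;> fin_cases j <;>
      simp [projector, outcomeSign, Fin.sum_univ_two] <;> ring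

lemma star_wState_dotProduct_mulVec (T : Matrix (Fin 3 → Fin 2) (Fin 3 → Fin 2) ℂ) :
    star wState ⬝ᵥ T.mulVec wState =
      1 / 3 * (T ![0, 0, 1] ![0, 0, 1] + T ![0, 0, 1] ![0, 1, 0] + T ![0, 0, 1] ![1, 0, 0] +
        (T ![0, 1, 0] ![0, 0, 1] + T ![0, 1, 0] ![0, 1, 0] + T ![0, 1, 0] ![1, 0, 0]) +
        (T ![1, 0, 0] ![0, 0, 1] + T ![1, 0, 0] ![0, 1, 0] + T ![1, 0, 0] ![1, 0, 0])) := by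
  have h3 : (Real.sqrt 3 : ℂ) * (Real.sqrt 3 : ℂ) = 3 := by
    rw [← Complex.ofReal_mul, Real.mul_self_sqrt (by norm_num)]
    norm_num
  have hstar (s : Fin 3 → Fin 2) : star (ket s) = ket s := by
    simp [ket]
  have hket (s t : Fin 3 → Fin 2) : ket s ⬝ᵥ T.mulVec (ket t) = T s t := by
    simp [ket]
  have hc : star (1 / (Real.sqrt 3 : ℂ)) * (1 / (Real.sqrt 3 : ℂ)) = 1 / 3 := by
    rw [show star (1 / (Real.sqrt 3 : ℂ)) = 1 / (Real.sqrt 3 : ℂ) by simp, div_mul_div_comm, h3,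
      one_mul]
  rw [wState, star_smul, Matrix.mulVec_smul, smul_dotProduct, dotProduct_smul, smul_smul, hc]
  simp only [star_add, hstar, Matrix.mulVec_add, add_dotProduct, dotProduct_add, hket, smul_eq_mul]
  ring

lemma star_wState_dotProduct : star wState ⬝ᵥ wState = 1 := by
  have := star_wState_dotProduct_mulVec 1
  rw [Matrix.one_mulVec] at this
  rw [this]
  simp
  norm_num

/-- The correlations of the W state for measurements of `c Z + s X`. -/
lemma bornBehaviour_wState {I : Type} (c s : I → ℝ) (h : ∀ α, c α ^ 2 + s α ^ 2 = 1)
    (x : Fin 3 → I) (a : Fin 3 → Fin 2) :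
    bornBehaviour (X := fun _ => I) (A := fun _ => Fin 2) wState
        (fun _ α => blochMeasurement (c α) (s α) (h α)) x a =
      1 / 24 *
        ((1 - outcomeSign (a 0) * c (x 0)) * (1 + outcomeSign (a 1) * c (x 1)) *
            (1 + outcomeSign (a 2) * c (x 2)) +
          (1 + outcomeSign (a 0) * c (x 0)) * (1 - outcomeSign (a 1) * c (x 1)) *
            (1 + outcomeSign (a 2) * c (x 2)) +
          (1 + outcomeSign (a 0) * c (x 0)) * (1 + outcomeSign (a 1) * c (x 1)) *
            (1 - outcomeSign (a 2) * c (x 2)) +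
          2 * (outcomeSign (a 0) * s (x 0)) * (outcomeSign (a 1) * s (x 1)) *
            (1 + outcomeSign (a 2) * c (x 2)) +
          2 * (outcomeSign (a 0) * s (x 0)) * (1 + outcomeSign (a 1) * c (x 1)) *
            (outcomeSign (a 2) * s (x 2)) +
          2 * (1 + outcomeSign (a 0) * c (x 0)) * (outcomeSign (a 1) * s (x 1)) *
            (outcomeSign (a 2) * s (x 2))) := by
  rw [bornBehaviour, star_wState_dotProduct_mulVec, ← Complex.ofReal_re (1 / 24 * _)]
  congr 1
  simp only [tensorOp, Matrix.of_apply, Fin.prod_univ_three, blochMeasurement, projector]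
  simp
  ring

/-- The cosines of the angles of the five settings. -/
noncomputable def settingCos : Fin 5 → ℝ := ![1, 4 / 5, 7 / 25, -44 / 125, -527 / 625]

/-- The sines of the angles of the five settings. -/
noncomputable def settingSin : Fin 5 → ℝ := ![0, -3 / 5, 24 / 25, -117 / 125, 336 / 625]

lemma settingCos_sq_add_settingSin_sq (α : Fin 5) : settingCos α ^ 2 + settingSin α ^ 2 = 1 := by
  fin_cases α <;> simp [settingCos, settingSin] <;> norm_num

/-- The five measurements of every party. -/
noncomputable def settingMeasurement (α : Fin 5) : QubitMeasurement (Fin 2) :=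
  blochMeasurement (settingCos α) (settingSin α) (settingCos_sq_add_settingSin_sq α)

/-- The correlations of the W state for five measurements per party. -/
noncomputable def wBehaviour : FiveInputBehaviour :=
  bornBehaviour wState fun _ α => settingMeasurement α

/-- Outcome 0 of `Z` has probability 2/3 and leaves `(|01⟩ + |10⟩) / √2`, whose correlator is minus
the cosine of the sum of the two angles. -/
lemma wBehaviour_cond (i : Fin 3) (α β : Fin 5) (u v : Fin 2) :
    wBehaviour.cond i α β u v = 1 / 6 * (1 -
      outcomeSign u * outcomeSign v *
        (settingCos α * settingCos β - settingSin α * settingSin β)) := by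
  have h := bornBehaviour_wState settingCos settingSin settingCos_sq_add_settingSin_sq
    (cyc i α β 0) (cyc i u v 0)
  refine h.trans ?_
  have hc : settingCos 0 = 1 := rfl
  have hs : settingSin 0 = 0 := rfl
  have ho : outcomeSign 0 = 1 := rfl
  fin_cases i <;> simp [cyc, hc, hs, ho] <;> ring

lemma wBehaviour_zero (a : Fin 3 → Fin 2) (ha : ∀ i, a ≠ Pi.single i 1) :
    wBehaviour (fun _ => 0) a = 0 := by
  have h := bornBehaviour_wState settingCos settingSin settingCos_sq_add_settingSin_sq
    (fun _ => 0) a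
  refine h.trans ?_
  have hc : settingCos 0 = 1 := rfl
  have hs : settingSin 0 = 0 := rfl
  have key : ∀ a : Fin 3 → Fin 2, (∀ i, a ≠ Pi.single i 1) →
      (a 0 = 0 ∧ a 1 = 0 ∧ a 2 = 0) ∨ (a 0 = 1 ∧ a 1 = 1) ∨ (a 1 = 1 ∧ a 2 = 1) ∨
        (a 0 = 1 ∧ a 2 = 1) := by decide
  rcases key a ha with ⟨h0, h1, h2⟩ | ⟨h0, h1⟩ | ⟨h0, h1⟩ | ⟨h0, h1⟩ <;>
    simp [outcomeSign, *]

/-- Setting `α` has angle `(-1) ^ α * α * θ` with `cos θ = 4 / 5`, a rational stand-in for `θ = π /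
5`. The angles add up to `±θ` on the first four links and to `4 * θ` on the last, so each pair
contributes `4 / 15 + 98 / 1875` and the total is `598 / 625`. With four links and `θ = π / 4` the
analogous total would exceed 1. -/
lemma sum_chainedBell_wBehaviour_lt_one : ∑ i, chainedBell (wBehaviour.cond i) < 1 := by
  simp only [chainedBell, wBehaviour_cond, Fin.sum_univ_three]
  simp [settingCos, settingSin, outcomeSign]
  norm_num

end LOSR

theorem proposition2 :
    ∃ (m k : Fin 3 → ℕ)
      (M : ∀ i : Fin 3, Fin (m i) → LOSR.QubitMeasurement (Fin (k i))),
      LOSR.IsGenuinelyLOSRTripartiteNonlocal (LOSR.bornBehaviour LOSR.wState M) :=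
  ⟨fun _ => 5, fun _ => 2, fun _ α => LOSR.settingMeasurement α,
    LOSR.isNonsignalling_bornBehaviour LOSR.star_wState_dotProduct _,
    fun h => LOSR.sum_chainedBell_wBehaviour_lt_one.not_ge
      (h.one_le_chainedBell LOSR.wBehaviour_zero)⟩
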